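/- Let $n,k,r$ be integers with $n\ge 1$, $0\le k\le n$ and $r\ge 2$. Let $I_{n,k}\subseteq\mathbb{C}[x_1,\dots,x_n]$ be the ideal generated by $x_1^{kr+1},\dots,x_n^{kr+1}$ together with $e_d(x_1^r,\dots,x_n^r)$ for $n-k+1\le d\le n$, where $e_d$ is the $d$-th elementary symmetric polynomial, and let $R_{n,k}=\mathbb{C}[x_1,\dots,x_n]/I_{n,k}$. An $r$-colored word of length $m$ on $[n]$ is $g=\pi_1^{c_1}\cdots\pi_m^{c_m}$ with distinct letters $\pi_i\in[n]$ and colors $0\le c_i\le r-1$; it is an $r$-colored permutation if $m=n$. Order colored letters by $i^c<j^d$ iff $c>d$, or $c=d$ and $i<j$. Put $\mathrm{Des}(g)=\{1\le i\le m-1:\pi_i^{c_i}>\pi_{i+1}^{c_{i+1}}\}$, $\mathrm{des}(g)=|\mathrm{Des}(g)|$, $d_i(g)=|\{j\in\mathrm{Des}(g): j\ge i\}|$, and $b_g=\prod_{i=1}^m x_{\pi_i}^{r d_i(g)+c_i}$. For $S\subseteq[n]$ with $|S|=m\ge k$, the $(m,k)$-descent monomials on the variables $\{x_j:j\in S\}$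 are the monomials $b_g\, x_{\pi_1}^{r i_1}\cdots x_{\pi_{m-k}}^{r i_{m-k}}$, where $g$ is a colored word using each letter of $S$ exactly once, $\mathrm{des}(g)<k$, and $k-\mathrm{des}(g)>i_1\ge\cdots\ge i_{m-k}\ge 0$. For $k\ge1$ let $\mathcal{ED}_{n,k}$ be the set of all monomials $$\Bigl(\prod_{j=1}^z x_{\pi_j}^{kr}\Bigr)\cdot b_{\bar g}\cdot x_{\pi_{z+1}}^{r i_{z+1}}\cdots x_{\pi_{n-k}}^{r i_{n-k}},$$ where $0\le z\le n-k$, $\pi_1^{c_1}\cdots\pi_n^{c_n}$ is an $r$-colored permutation whose suffix $\bar g=\pi_{z+1}^{c_{z+1}}\cdots\pi_n^{c_n}$ has $\mathrm{des}(\bar g)<k$, and $k-\mathrm{des}(\bar g)>i_{z+1}\ge\cdots\ge i_{n-k}\ge0$. Put $\mathcal{ED}_{n,0}=\{1\}$. Theorem. The set $\mathcal{ED}_{n,k}$ of extended $(n,k)$-descent monomials descends to a $\mathbb{C}$-basis of $R_{n,k}$: the cosets of its elements, indexed by the elements of $\mathcal{ED}_{n,k}$, form a basis. Moreover, if $k\ge1$,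 a polynomial lies in $\mathcal{ED}_{n,k}$ if and only if it equals $\prod_{j\in Z}x_j^{kr}\cdot q$ for some $Z\subseteq[n]$ with $z=|Z|\le n-k$ and some $(n-z,k)$-descent monomial $q$ on the variables $\{x_j:j\notin Z\}$. -/

import Mathlib

noncomputable section

namespace DescentBasis

/-- A (partial) `r`-colored permutation `π₁^{c₁} … π_m^{c_m}` of length `m`: the letters
`π₁, …, π_m` are distinct elements of `[n]` (modelled by `Fin n`), the colors lie in
`{0, …, r - 1}`.  For `m = n` these are exactly the elements of `G_n = G(r,1,n)`. -/
structure ColoredPerm (n r m : ℕ) where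
  letter : Fin m ↪ Fin n
  color : Fin m → Fin r

/-- The order `<` on colored letters `i^c`: higher colors are smaller, and letters of the
same color are compared by value. -/
def ColoredLT {n r : ℕ} (a b : Fin n × Fin r) : Prop :=
  b.2 < a.2 ∨ (a.2 = b.2 ∧ a.1 < b.1)

namespace ColoredPerm

variable {n r m : ℕ}

/-- The colored letter in position `i`. -/
def entry (g : ColoredPerm n r m) (i : Fin m) : Fin n × Fin r := (g.letter i, g.color i)

open scoped Classical in
/-- The descent set: the positions `i`, not the last one, whose colored letter is larger
than the next one. -/
def Des (g : ColoredPerm n r m) : Finset (Fin m) :=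
  Finset.univ.filter fun i => ∃ h : (i : ℕ) + 1 < m, ColoredLT (g.entry ⟨i + 1, h⟩) (g.entry i)

/-- The number of descents. -/
def des (g : ColoredPerm n r m) : ℕ := g.Des.card

/-- `d_i(g)`: the number of descents at positions `j ≥ i`. -/
def d (g : ColoredPerm n r m) (i : Fin m) : ℕ := (g.Des.filter fun j => i ≤ j).card

/-- The descent monomial `b_g = ∏ i, x_{π_i} ^ (r d_i(g) + c_i)`. -/
def descentMonomial (g : ColoredPerm n r m) : MvPolynomial (Fin n) ℂ :=
  ∏ i : Fin m, MvPolynomial.X (g.letter i) ^ (r * g.d i + (g.color i : ℕ))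

/-- The word obtained by erasing the first `z` letters. -/
def suffix (g : ColoredPerm n r m) (z : ℕ) : ColoredPerm n r (m - z) where
  letter := ⟨fun i => g.letter ⟨z + i, by omega⟩, fun i j h => by
    have h' := congrArg Fin.val (g.letter.injective h)
    exact Fin.ext (Nat.add_left_cancel h')⟩
  color := fun i => g.color ⟨z + i, by omega⟩

/-- `b_g · x_{π_1}^{r i_1} ⋯ x_{π_{m-k}}^{r i_{m-k}}` for a word `g` of length `m`. -/
def extendedMonomial (g : ColoredPerm n r m) (k : ℕ) (e : Fin (m - k) → ℕ) :
    MvPolynomial (Fin n) ℂ :=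
  g.descentMonomial *
    ∏ j : Fin (m - k), MvPolynomial.X (g.letter (Fin.castLE (Nat.sub_le m k) j)) ^ (r * e j)

/-- The condition on `g` and on the sequence `(i_1, …, i_{m-k})` of extra exponents:
`des g < k` and `k - des g > i_1 ≥ ⋯ ≥ i_{m-k} ≥ 0`. -/
def Admissible (g : ColoredPerm n r m) (k : ℕ) (e : Fin (m - k) → ℕ) : Prop :=
  g.des < k ∧ Antitone e ∧ ∀ j, e j < k - g.des

end ColoredPerm

/-- The `(|S|, k)`-descent monomials on the variable set `{x_j : j ∈ S}`. For `S = [n]`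
this is the set `D_{n,k}`. -/
def descentMonomials (n k r : ℕ) (S : Finset (Fin n)) : Set (MvPolynomial (Fin n) ℂ) :=
  {f | ∃ (m : ℕ) (g : ColoredPerm n r m) (e : Fin (m - k) → ℕ),
    Finset.univ.map g.letter = S ∧ g.Admissible k e ∧ f = g.extendedMonomial k e}

/-- The extended `(n, k)`-descent monomials `ED_{n,k}`, with `ED_{n,0} = {1}`. -/
def extendedDescentMonomials (n k r : ℕ) : Set (MvPolynomial (Fin n) ℂ) :=
  if k = 0 then {1} else
  {f | ∃ (z : ℕ) (g : ColoredPerm n r n) (e : Fin (n - z - k) → ℕ),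
    z ≤ n - k ∧ (g.suffix z).Admissible k e ∧
    f = (∏ j ∈ Finset.univ.filter (fun j : Fin n => (j : ℕ) < z),
          MvPolynomial.X (g.letter j) ^ (k * r)) * (g.suffix z).extendedMonomial k e}

/-- `e_d(x_1^r, …, x_n^r)`. -/
def esymmPow (n r d : ℕ) : MvPolynomial (Fin n) ℂ :=
  MvPolynomial.expand r (MvPolynomial.esymm (Fin n) ℂ d)

/-- The ideal `I_{n,k}`, generated by `x_1^{kr+1}, …, x_n^{kr+1}` and `e_d(x_1^r, …, x_n^r)` for
`n - k + 1 ≤ d ≤ n`. -/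
def idealI (n k r : ℕ) : Ideal (MvPolynomial (Fin n) ℂ) :=
  Ideal.span ({f | ∃ i : Fin n, f = MvPolynomial.X i ^ (k * r + 1)} ∪
    {f | ∃ d : ℕ, n - k + 1 ≤ d ∧ d ≤ n ∧ f = esymmPow n r d})

/-- The quotient ring `R_{n,k} = ℂ[x_1, …, x_n] / I_{n,k}`. -/
abbrev ringR (n k r : ℕ) : Type := MvPolynomial (Fin n) ℂ ⧸ idealI n k r

end DescentBasis

end

noncomputable section

namespace DescentBasis

open MvPolynomial Finset

variable {n : ℕ}

/-! Order the indices by decreasing exponent. If lowering the exponents on S by r keeps S in front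
of its complement, then x^a is one term of the product of the lowered monomial with e_{|S|}(x^r),
and by rearrangement every other term has smaller `weight`. Modulo the e_d with d > n - k, monomials
thus reduce to those whose gap sets have at most n - k elements (`NoGap`). Since exponents above kr
are killed, the `Good` monomials span the quotient (`mon_mem_span_good`).

For independence, products of a `NoGap` monomial with powers of the e_d, d > n - k, form a basis of
the polynomial ring. They span by the same straightening, which preserves degree. Since `lead`
injects the indices of degree at most W into the exponent vectors of degree at most W, a dimension
count makes them independent (`linearIndependent_normalElt`). The ideal generated by the e_d lies in
the span of the products with a nontrivial e-factor, and by `mon_mem_of_lt` the power generators add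
only `NoGap` monomials with an exponent above kr. So the ideal meets the span of the `Good`
monomials trivially.

Finally, `Good` vectors are matched with words: set aside the variables with exponent kr, list the
others by decreasing key, and write each exponent as rq + c with c the color. Sorting makes q - d
weakly decreasing along the word; the absence of large gap sets makes it vanish on the last k
letters. Its earlier values are the extra exponents. -/

/-! ### Monomials and elementary symmetric polynomials in r-th powers. -/

/-- The monomial with exponent vector `a`. -/
def mon (a : Fin n → ℕ) : MvPolynomial (Fin n) ℂ := ∏ i, X i ^ a i

lemma mon_eq_monomial (a : Fin n → ℕ) :
    mon a = monomial (Finsupp.equivFunOnFinite.symm a) 1 := by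
  rw [mon, monomial_eq, Finsupp.prod_fintype _ _ (by simp)]
  simp

lemma mon_add (a b : Fin n → ℕ) : mon (a + b) = mon a * mon b := by
  simp [mon, pow_add, prod_mul_distrib]

lemma mon_zero : mon (0 : Fin n → ℕ) = 1 := by simp [mon]

/-- The exponent vector of `∏ i ∈ T, x_i ^ r`. -/
def ind (r : ℕ) (T : Finset (Fin n)) : Fin n → ℕ := fun i => if i ∈ T then r else 0

lemma mon_ind (r : ℕ) (T : Finset (Fin n)) : mon (ind r T) = ∏ i ∈ T, X i ^ r := by
  simp [mon, ind, pow_ite, prod_ite_mem]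

lemma sum_ind (r : ℕ) (T : Finset (Fin n)) : ∑ i, ind r T i = r * #T := by
  simp [ind, sum_ite_mem, mul_comm]

/-- The `d`-th elementary symmetric polynomial in the `r`-th powers of the variables in `U`. -/
def esymmOn (r : ℕ) (U : Finset (Fin n)) (d : ℕ) : MvPolynomial (Fin n) ℂ :=
  ∑ T ∈ powersetCard d U, mon (ind r T)

lemma esymmPow_eq (r d : ℕ) : esymmPow n r d = esymmOn r univ d := by
  simp [esymmPow, esymmOn, esymm, mon_ind]

lemma esymmOn_insert (r d : ℕ) {U : Finset (Fin n)} {i : Fin n} (hi : i ∉ U) :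
    esymmOn r (insert i U) (d + 1) = esymmOn r U (d + 1) + X i ^ r * esymmOn r U d := by
  have key : ∀ T ∈ powersetCard d U, i ∉ T := fun T hT h => hi ((mem_powersetCard.1 hT).1 h)
  rw [esymmOn, powersetCard_succ_insert hi, sum_union, sum_image, esymmOn, esymmOn, mul_sum]
  · congr 1
    refine sum_congr rfl fun T hT => ?_
    rw [mon_ind, mon_ind, prod_insert (key T hT)]
  · intro T hT T' hT' h
    rw [← erase_insert (key T hT), ← erase_insert (key T' hT'), h]
  · rw [disjoint_left]
    intro T hT hT'
    obtain ⟨T', -, rfl⟩ := mem_image.1 hT'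
    exact hi ((mem_powersetCard.1 hT).1 (mem_insert_self i T'))

/-! ### Gap sets and the straightening step. -/

/-- The keys order the indices by decreasing exponent, ties being broken by the index. -/
def key (a : Fin n → ℕ) (i : Fin n) : ℕ := n * a i + (i.rev : ℕ)

lemma key_add_lt_key_iff {s : ℕ} {a : Fin n → ℕ} {i j : Fin n} :
    key a j + s * n < key a i ↔ a j + s < a i ∨ (a j + s = a i ∧ i < j) := by
  have hi := i.rev.isLt
  have hj := j.rev.isLt
  have h : i < j ↔ (j.rev : ℕ) < i.rev := by rw [← Fin.lt_def, Fin.rev_lt_rev]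
  rw [h, key, key]
  rcases lt_trichotomy (a j + s) (a i) with hlt | heq | hgt
  · have : n * (a j + s + 1) ≤ n * a i := Nat.mul_le_mul_left n hlt
    simp only [hlt, true_or, iff_true]
    nlinarith
  · rw [← heq]
    simp only [lt_irrefl, true_and, false_or]
    constructor <;> intro <;> nlinarith
  · have : n * (a i + 1) ≤ n * (a j + s) := Nat.mul_le_mul_left n hgt
    constructor
    · intro; nlinarith
    · rintro (h | h) <;> omega

lemma key_lt_key_iff {a : Fin n → ℕ} {i j : Fin n} :
    key a j < key a i ↔ a j < a i ∨ (a j = a i ∧ i < j) := by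
  simpa using key_add_lt_key_iff (s := 0) (a := a) (i := i) (j := j)

lemma key_injective (a : Fin n → ℕ) : Function.Injective (key a) := by
  intro i j h
  have h1 := (key_lt_key_iff (a := a) (i := i) (j := j)).not.1 h.le.not_gt
  have h2 := (key_lt_key_iff (a := a) (i := j) (j := i)).not.1 h.ge.not_gt
  push Not at h1 h2
  have : a i = a j := le_antisymm (by omega) (by omega)
  exact le_antisymm (h2.2 this) (h1.2 this.symm)

/-- `S ⊆ U` is a gap set of `a` relative to `U` if lowering the exponents on `S` by `r` keeps
the indices in `S` in front of those in `U \ S`. -/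
structure IsGap (r : ℕ) (a : Fin n → ℕ) (U S : Finset (Fin n)) : Prop where
  subset : S ⊆ U
  le : ∀ i ∈ S, r ≤ a i
  lt : ∀ i ∈ S, ∀ j ∈ U \ S, key a j + r * n < key a i

/-- A strictly convex measure of exponent vectors. -/
def weight (a : Fin n → ℕ) : ℕ := ∑ i, key a i ^ 2

lemma key_add_ind (r : ℕ) (a : Fin n → ℕ) (T : Finset (Fin n)) (i : Fin n) :
    key (a + ind r T) i = key a i + if i ∈ T then r * n else 0 := by
  simp only [key, Pi.add_apply, ind]
  split_ifs <;> ring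

lemma weight_add_ind (r : ℕ) (a : Fin n → ℕ) (T : Finset (Fin n)) :
    weight (a + ind r T) = weight a + 2 * r * n * ∑ i ∈ T, key a i + #T * (r * n) ^ 2 := by
  have : ∀ i, key (a + ind r T) i ^ 2 =
      key a i ^ 2 + if i ∈ T then (2 * r * n * key a i + (r * n) ^ 2) else 0 := by
    intro i
    rw [key_add_ind]
    split_ifs <;> ring
  simp only [weight, this, sum_add_distrib, sum_ite_mem, univ_inter, sum_const, smul_eq_mul,
    mul_sum]
  ring

/-- The common part of T and S cancels; the maximum of f on U \ S separates the equally many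
remaining terms. -/
lemma sum_lt_sum_of_separated {ι : Type*} [DecidableEq ι] {f : ι → ℕ} {U S T : Finset ι}
    (hT : T ⊆ U) (hST : #T = #S) (hne : T ≠ S) (h : ∀ i ∈ S, ∀ j ∈ U \ S, f j < f i) :
    ∑ i ∈ T, f i < ∑ i ∈ S, f i := by
  have hcard : #(T \ S) = #(S \ T) := card_sdiff_comm hST
  have hpos : 0 < #(S \ T) := by
    rw [card_pos, sdiff_nonempty]
    exact fun hs => hne (eq_of_subset_of_card_le hs hST.le).symm
  set c := (U \ S).sup f
  have h1 : ∀ j ∈ T \ S, f j ≤ c := fun j hj =>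
    le_sup (f := f) (mem_sdiff.2 ⟨hT (mem_sdiff.1 hj).1, (mem_sdiff.1 hj).2⟩)
  have h2 : ∀ i ∈ S \ T, c + 1 ≤ f i := by
    intro i hi
    obtain ⟨j, hj⟩ := card_pos.1 (hcard ▸ hpos)
    have hj' : j ∈ U \ S := mem_sdiff.2 ⟨hT (mem_sdiff.1 hj).1, (mem_sdiff.1 hj).2⟩
    refine (Finset.sup_lt_iff ?_).2 fun j hj => h i (mem_sdiff.1 hi).1 j hj
    exact lt_of_le_of_lt bot_le (h i (mem_sdiff.1 hi).1 j hj')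
  have e1 := sum_le_card_nsmul _ _ _ h1
  have e2 := card_nsmul_le_sum _ _ _ h2
  rw [← sum_inter_add_sum_sdiff T S f, ← sum_inter_add_sum_sdiff S T f, inter_comm S T]
  simp only [smul_eq_mul] at e1 e2
  rw [hcard] at e1
  nlinarith

/-- For fixed cardinality, the weight after raising T depends on T only through the sum of the old
keys over T, and S carries the largest keys in U. -/
lemma weight_lt_of_isGap {r : ℕ} (hr : 0 < r) {a : Fin n → ℕ} {U S T : Finset (Fin n)}
    (hS : IsGap r (a + ind r S) U S) (hT : T ⊆ U) (hST : #T = #S) (hne : T ≠ S) :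
    weight (a + ind r T) < weight (a + ind r S) := by
  have h := sum_lt_sum_of_separated (f := key a) hT hST hne fun i hi j hj => by
    have := hS.lt i hi j hj
    simp only [key_add_ind, hi, (mem_sdiff.1 hj).2, if_true, if_false] at this
    omega
  have hn : 0 < n := by
    rcases n with _ | n
    · exact absurd (Subsingleton.elim T S) hne
    · omega
  rw [weight_add_ind, weight_add_ind, hST]
  have : 0 < 2 * r * n := by positivity
  have := Nat.mul_lt_mul_of_pos_left h this
  omega

lemma sub_ind_add_ind {r : ℕ} {a : Fin n → ℕ} {U S : Finset (Fin n)} (hS : IsGap r a U S) :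
    a - ind r S + ind r S = a := by
  funext i
  by_cases hi : i ∈ S
  · have := hS.le i hi
    simp [ind, hi, this]
  · simp [ind, hi]

lemma mon_mul_esymmOn (r : ℕ) (a : Fin n → ℕ) {U S : Finset (Fin n)} (hS : S ⊆ U) :
    mon a * esymmOn r U #S =
      mon (a + ind r S) + ∑ T ∈ (powersetCard #S U).erase S, mon (a + ind r T) := by
  rw [esymmOn, mul_sum, ← add_sum_erase _ _ (mem_powersetCard.2 ⟨hS, rfl⟩)]
  simp [mon_add]

/-- One straightening step. -/
lemma mon_mem_of_isGap {r : ℕ} (hr : 0 < r) {a : Fin n → ℕ} {U S : Finset (Fin n)}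
    (hS : IsGap r a U S) (N : Submodule ℂ (MvPolynomial (Fin n) ℂ))
    (h1 : mon (a - ind r S) * esymmOn r U #S ∈ N)
    (h2 : ∀ b, weight b < weight a → (∀ i ∉ U, b i = a i) → ∑ i, b i = ∑ i, a i → mon b ∈ N) :
    mon a ∈ N := by
  have ha := sub_ind_add_ind hS
  have e := mon_mul_esymmOn r (a - ind r S) hS.subset
  rw [ha] at e
  rw [← sub_eq_of_eq_add e]
  refine N.sub_mem h1 (N.sum_mem fun T hT => ?_)
  obtain ⟨hne, hT⟩ := mem_erase.1 hT
  obtain ⟨hTU, hcard⟩ := mem_powersetCard.1 hT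
  refine h2 _ ?_ (fun i hi => ?_) ?_
  · conv_rhs => rw [← ha]
    exact weight_lt_of_isGap hr (by rwa [ha]) hTU hcard hne
  · have h3 : i ∉ T := fun h => hi (hTU h)
    have h4 : i ∉ S := fun h => hi (hS.subset h)
    simp [ind, h3, h4]
  · conv_rhs => rw [← ha]
    simp only [Pi.add_apply, sum_add_distrib, sum_ind, hcard]

/-! ### Straightening modulo the ideal. -/

/-- No gap set has more than `n - k` elements. -/
def NoGap (k r : ℕ) (a : Fin n → ℕ) : Prop := ∀ S, IsGap r a univ S → #S ≤ n - k

/-- The ideal generated by the symmetric generators of `idealI`. -/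
def idealE (n k r : ℕ) : Ideal (MvPolynomial (Fin n) ℂ) :=
  Ideal.span {f | ∃ d : ℕ, n - k + 1 ≤ d ∧ d ≤ n ∧ f = esymmPow n r d}

lemma esymmOn_univ_mem_idealE {k r d : ℕ} (hd : n - k < d) :
    esymmOn r univ d ∈ idealE n k r := by
  by_cases h : d ≤ n
  · exact Ideal.subset_span ⟨d, hd, h, (esymmPow_eq r d).symm⟩
  · rw [esymmOn, powersetCard_eq_empty.2 (by simpa using h)]
    simp

/-- Each factor x_i^r trades e_d without x_i for the full e_{d+1}, which lies in the ideal, minus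
e_{d+1} without x_i. The induction ends at degree n, where n - 1 variables leave an empty sum. -/
lemma pow_mul_esymmOn_mem_idealE {k r : ℕ} (i : Fin n) :
    ∀ j ≤ k, ∀ d, n - j ≤ d → X i ^ (j * r) * esymmOn r (univ.erase i) d ∈ idealE n k r := by
  intro j
  induction j with
  | zero =>
    intro _ d hd
    have := i.isLt
    rw [esymmOn, powersetCard_eq_empty.2 (by simp; omega)]
    simp
  | succ j ih =>
    intro hj d hd
    have e := esymmOn_insert r d (notMem_erase i (univ : Finset (Fin n)))
    rw [insert_erase (mem_univ i)] at e
    have : X i ^ ((j + 1) * r) * esymmOn r (univ.erase i) d =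
        X i ^ (j * r) * esymmOn r univ (d + 1) -
          X i ^ (j * r) * esymmOn r (univ.erase i) (d + 1) := by
      rw [e]; ring
    rw [this]
    exact Ideal.sub_mem _ (Ideal.mul_mem_left _ _ (esymmOn_univ_mem_idealE (by omega)))
      (ih (by omega) _ (by omega))

/-- A monomial in which some exponent exceeds `k r` reduces, modulo `idealE`, to monomials without
large gap sets in which some exponent exceeds `k r`. -/
lemma mon_mem_of_lt {k r : ℕ} (hr : 0 < r) (i : Fin n) (a : Fin n → ℕ) (ha : k * r < a i) :
    mon a ∈ (idealE n k r).restrictScalars ℂ ⊔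
      Submodule.span ℂ (mon '' {b | NoGap k r b ∧ ∃ i, k * r < b i}) := by
  by_cases hg : NoGap k r a
  · exact Submodule.mem_sup_right (Submodule.subset_span ⟨a, ⟨hg, i, ha⟩, rfl⟩)
  simp only [NoGap, not_forall] at hg
  obtain ⟨S, hS, hcard⟩ := hg
  -- Straightening without the index i leaves its exponent above kr. This costs at most one element
  -- of S, so at least n - k remain, just enough for the factor x_i^(kr).
  have hS' : IsGap r a (univ.erase i) (S.erase i) :=
    { subset := erase_subset_erase _ (subset_univ S)
      le := fun j hj => hS.le j (mem_of_mem_erase hj)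
      lt := fun j hj l hl => hS.lt j (mem_of_mem_erase hj) l (by
        simp only [mem_sdiff, mem_erase, mem_univ, and_true] at hl ⊢
        tauto) }
  refine mon_mem_of_isGap hr hS' _ (Submodule.mem_sup_left ?_) ?_
  · obtain ⟨b, hb⟩ : ∃ b, a - ind r (S.erase i) = b + (Pi.single i (k * r) : Fin n → ℕ) := by
      refine ⟨a - ind r (S.erase i) - Pi.single i (k * r), ?_⟩
      funext j
      rcases eq_or_ne j i with rfl | hj
      · simp [ind]; omega
      · simp [hj]
    have h2 : mon (Pi.single i (k * r)) = (X i ^ (k * r) : MvPolynomial (Fin n) ℂ) := by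
      rw [mon, prod_eq_single i] <;> simp +contextual
    rw [hb, mon_add, h2, mul_assoc]
    refine Ideal.mul_mem_left _ _ (pow_mul_esymmOn_mem_idealE i k le_rfl _ ?_)
    have := pred_card_le_card_erase (s := S) (a := i)
    omega
  · intro b hb hbi _
    exact mon_mem_of_lt hr i b (by rw [hbi i (by simp)]; exact ha)
  termination_by weight a

lemma span_mon : Submodule.span ℂ (Set.range (mon (n := n))) = ⊤ := by
  rw [eq_top_iff, ← (basisMonomials (Fin n) ℂ).span_eq]
  refine Submodule.span_mono ?_
  rintro _ ⟨a, rfl⟩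
  refine ⟨a, ?_⟩
  rw [mon_eq_monomial, coe_basisMonomials]
  congr 1
  ext; simp

/-- As a vector space the ideal is spanned by monomial multiples of the generators; those of the
power generators are monomials with an exponent above kr. -/
lemma idealI_le {k r : ℕ} (hr : 0 < r) :
    (idealI n k r).restrictScalars ℂ ≤ (idealE n k r).restrictScalars ℂ ⊔
      Submodule.span ℂ (mon '' {b | NoGap k r b ∧ ∃ i, k * r < b i}) := by
  rw [idealI, Ideal.span, ← Submodule.span_smul_of_span_eq_top span_mon, Submodule.span_le]
  rintro _ ⟨_, ⟨a, rfl⟩, f, hf, rfl⟩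
  rcases hf with ⟨i, rfl⟩ | hf
  · have : mon a • (X i ^ (k * r + 1) : MvPolynomial (Fin n) ℂ) =
        mon (a + Pi.single i (k * r + 1)) := by
      rw [mon_add, smul_eq_mul]
      congr 1
      rw [mon, prod_eq_single i] <;> simp +contextual
    simp only [this]
    exact mon_mem_of_lt hr i _ (by simp; omega)
  · exact Submodule.mem_sup_left (Ideal.mul_mem_left _ _ (Ideal.subset_span hf))

lemma idealE_le_idealI (k r : ℕ) : idealE n k r ≤ idealI n k r :=
  Ideal.span_mono Set.subset_union_right

/-- The exponent vectors of the extended descent monomials. -/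
def Good (k r : ℕ) (a : Fin n → ℕ) : Prop := NoGap k r a ∧ ∀ i, a i ≤ k * r

lemma mon_mem_span_good {k r : ℕ} (hr : 0 < r) (a : Fin n → ℕ) :
    mon a ∈ (idealI n k r).restrictScalars ℂ ⊔ Submodule.span ℂ (mon '' {b | Good k r b}) := by
  by_cases hb : ∀ i, a i ≤ k * r
  · by_cases hg : NoGap k r a
    · exact Submodule.mem_sup_right (Submodule.subset_span ⟨a, ⟨hg, hb⟩, rfl⟩)
    simp only [NoGap, not_forall, not_le] at hg
    obtain ⟨S, hS, hcard⟩ := hg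
    exact mon_mem_of_isGap hr hS _
      (Submodule.mem_sup_left (Ideal.mul_mem_left _ _
        (idealE_le_idealI k r (esymmOn_univ_mem_idealE hcard))))
      fun b hb _ _ => mon_mem_span_good hr b
  · push Not at hb
    obtain ⟨i, hi⟩ := hb
    refine Submodule.mem_sup_left ?_
    rw [mon, ← mul_prod_erase _ _ (mem_univ i), ← Nat.sub_add_cancel hi, pow_add, mul_comm,
      ← mul_assoc]
    exact Ideal.mul_mem_left _ _ (Ideal.subset_span (Or.inl ⟨i, rfl⟩))
  termination_by weight a

/-! ### A basis of the polynomial ring adapted to the symmetric generators. -/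

/-- The number of indices in front of `i`. -/
def rank (a : Fin n → ℕ) (i : Fin n) : ℕ := #{l | key a i < key a l}

lemma rank_lt_rank_iff {a : Fin n → ℕ} {i l : Fin n} :
    rank a l < rank a i ↔ key a i < key a l := by
  have mono : ∀ {i l}, key a i < key a l → rank a l < rank a i := fun {i l} h =>
    card_lt_card ((ssubset_iff_of_subset fun x hx => by simp at hx ⊢; omega).2 ⟨l, by simpa⟩)
  refine ⟨fun h => ?_, mono⟩
  rcases lt_trichotomy (key a i) (key a l) with h' | h' | h'
  · exact h'
  · exact absurd h (by rw [key_injective a h']; exact lt_irrefl _)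
  · exact absurd (mono h') h.le.not_gt

lemma rank_injective (a : Fin n → ℕ) : Function.Injective (rank a) := by
  intro i l h
  have h1 := (rank_lt_rank_iff (a := a) (i := i) (l := l)).not.1 h.le.not_gt
  have h2 := (rank_lt_rank_iff (a := a) (i := l) (l := i)).not.1 h.ge.not_gt
  exact key_injective a (by omega)

lemma rank_lt (a : Fin n → ℕ) (i : Fin n) : rank a i < n := by
  have : rank a i < #(univ : Finset (Fin n)) := card_lt_card
    ((ssubset_iff_of_subset (subset_univ _)).2 ⟨i, mem_univ _, by simp⟩)
  simpa using this

lemma exists_rank_eq (a : Fin n → ℕ) {j : ℕ} (hj : j < n) : ∃ i, rank a i = j := by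
  have hinj : Function.Injective fun i => (⟨rank a i, rank_lt a i⟩ : Fin n) :=
    fun i l h => rank_injective a (by simpa using h)
  obtain ⟨i, hi⟩ := Finite.surjective_of_injective hinj ⟨j, hj⟩
  exact ⟨i, by simpa using hi⟩

/-- The first `j + 1` indices. -/
def top (a : Fin n → ℕ) (j : ℕ) : Finset (Fin n) := {i | rank a i ≤ j}

lemma card_top (a : Fin n → ℕ) {j : ℕ} (hj : j < n) : #(top a j) = j + 1 := by
  rw [← card_image_of_injective _ (rank_injective a), ← card_range (j + 1)]
  congr 1
  ext t
  simp only [top, mem_image, mem_filter, mem_univ, true_and, mem_range]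
  constructor
  · rintro ⟨i, hi, rfl⟩; omega
  · intro ht
    obtain ⟨i, rfl⟩ := exists_rank_eq a (show t < n by omega)
    exact ⟨i, by omega, rfl⟩

/-- The indices of the basis of the polynomial ring adapted to `idealE`: an exponent vector without
large gap sets, and the exponents of the elementary symmetric polynomials of large degree. -/
abbrev NormalIndex (n k r : ℕ) : Type :=
  {p : (Fin n → ℕ) × (Fin n → ℕ) // NoGap k r p.1 ∧ ∀ j, p.2 j ≠ 0 → n - k < (j : ℕ) + 1}

variable {k r : ℕ}

/-- The element of the adapted basis with the given index. -/
def normalElt (p : NormalIndex n k r) : MvPolynomial (Fin n) ℂ :=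
  mon p.1.1 * ∏ j : Fin n, esymmOn r univ ((j : ℕ) + 1) ^ p.1.2 j

/-- The exponent vector of the leading monomial of `normalElt p`. -/
def lead (p : NormalIndex n k r) : Fin n → ℕ :=
  p.1.1 + ∑ j : Fin n, p.1.2 j • ind r (top p.1.1 j)

/-- The degree of `normalElt p`. -/
def deg (p : NormalIndex n k r) : ℕ := ∑ i, p.1.1 i + ∑ j : Fin n, p.1.2 j * (r * ((j : ℕ) + 1))

lemma sum_lead (p : NormalIndex n k r) : ∑ i, lead p i = deg p := by
  simp only [lead, deg, Pi.add_apply, Finset.sum_apply, Pi.smul_apply, smul_eq_mul, sum_add_distrib]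
  rw [sum_comm]
  congr 1
  refine sum_congr rfl fun j _ => ?_
  rw [← mul_sum, sum_ind, card_top _ j.isLt]

/-- The multiple of `r` by which `lead` raises the exponent at an index of rank `t`. -/
def tail (m : Fin n → ℕ) (t : ℕ) : ℕ := ∑ j : Fin n, if t ≤ j then m j else 0

lemma tail_anti (m : Fin n → ℕ) : Antitone (tail m) := by
  intro s t h
  refine sum_le_sum fun j _ => ?_
  split_ifs <;> omega

lemma tail_eq (m : Fin n → ℕ) (j : Fin n) : tail m j = m j + tail m (j + 1) := by
  have hm : m j = ∑ t, if t = j then m t else 0 := by simp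
  rw [tail, tail, hm, ← sum_add_distrib]
  refine sum_congr rfl fun t _ => ?_
  rcases lt_trichotomy t j with h | rfl | h
  · have h1 : ¬ (j : ℕ) ≤ t := by simpa using h
    have h2 : ¬ (j : ℕ) + 1 ≤ t := by omega
    simp [h.ne, h1, h2]
  · simp
  · have h1 : (j : ℕ) ≤ t := h.le
    have h2 : (j : ℕ) + 1 ≤ t := h
    simp [h.ne', h1, h2]

lemma tail_eq_zero (m : Fin n → ℕ) : tail m n = 0 :=
  sum_eq_zero fun j _ => if_neg j.isLt.not_ge

lemma lead_apply (p : NormalIndex n k r) (i : Fin n) :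
    lead p i = p.1.1 i + r * tail p.1.2 (rank p.1.1 i) := by
  simp only [lead, tail, Pi.add_apply, Finset.sum_apply, Pi.smul_apply, smul_eq_mul, mul_sum, ind, top,
    mem_filter, mem_univ, true_and]
  congr 1
  refine sum_congr rfl fun j _ => ?_
  split_ifs <;> ring

lemma key_lead (p : NormalIndex n k r) (i : Fin n) :
    key (lead p) i = key p.1.1 i + r * n * tail p.1.2 (rank p.1.1 i) := by
  rw [key, lead_apply, key]; ring

/-- Indices further in front are raised at least as much, so `lead` preserves the order and the
ranks can be read off from it. -/
lemma key_lead_lt_iff (p : NormalIndex n k r) (i l : Fin n) :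
    key (lead p) i < key (lead p) l ↔ key p.1.1 i < key p.1.1 l := by
  have mono : ∀ {i l}, key p.1.1 i < key p.1.1 l → key (lead p) i < key (lead p) l := by
    intro i l h
    rw [key_lead, key_lead]
    have := Nat.mul_le_mul_left (r * n) (tail_anti p.1.2 (rank_lt_rank_iff.2 h).le)
    omega
  refine ⟨fun h => ?_, mono⟩
  rcases lt_trichotomy (key p.1.1 i) (key p.1.1 l) with h' | h' | h'
  · exact h'
  · exact absurd h (by rw [key_injective _ h']; exact lt_irrefl _)
  · exact absurd (mono h') h.le.not_gt

lemma rank_lead (p : NormalIndex n k r) : rank (lead p) = rank p.1.1 := by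
  funext i
  simp only [rank, key_lead_lt_iff]

/-- If p had the larger multiplicity at j, equality of the leads would force a drop of more than rn
in the keys of q between ranks j and j + 1. The first j + 1 indices would then be a gap set of q,
too large because p uses e_{j+1}. -/
lemma snd_le_of_lead_eq {p q : NormalIndex n k r} (h : lead p = lead q) : p.1.2 ≤ q.1.2 := by
  intro j
  by_contra hlt
  rw [not_le] at hlt
  have hrank : rank p.1.1 = rank q.1.1 := by rw [← rank_lead, h, rank_lead]
  have hlead : ∀ i, key p.1.1 i + r * n * tail p.1.2 (rank q.1.1 i) =
      key q.1.1 i + r * n * tail q.1.2 (rank q.1.1 i) := by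
    intro i
    rw [← key_lead, ← hrank, ← key_lead, h]
  obtain ⟨i, hi⟩ := exists_rank_eq q.1.1 j.isLt
  have hle : ∀ x ∈ top q.1.1 j, key q.1.1 i ≤ key q.1.1 x := by
    intro x hx
    rw [← not_lt, ← rank_lt_rank_iff, hi]
    simpa [top] using hx
  have hmul : r * n * (q.1.2 j + 1) ≤ r * n * p.1.2 j := Nat.mul_le_mul_left _ hlt
  have hr' : r ≤ q.1.1 i ∧ ∀ l ∉ top q.1.1 j, key q.1.1 l + r * n < key q.1.1 i := by
    have hi' := hlead i
    rw [hi, tail_eq, tail_eq q.1.2, mul_add, mul_add] at hi'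
    by_cases hj : (j : ℕ) + 1 < n
    · obtain ⟨l, hl⟩ := exists_rank_eq q.1.1 hj
      have hl' := hlead l
      rw [hl] at hl'
      have hil : key p.1.1 l < key p.1.1 i := by
        rw [← rank_lt_rank_iff, hrank, hi, hl]; omega
      have hlt' : key q.1.1 l + r * n < key q.1.1 i := by linarith
      refine ⟨?_, fun x hx => ?_⟩
      · rcases key_add_lt_key_iff.1 hlt' with h | h <;> omega
      · have : key q.1.1 x ≤ key q.1.1 l := by
          rw [← not_lt, ← rank_lt_rank_iff, hl]
          simp only [top, mem_filter, mem_univ, true_and] at hx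
          omega
        omega
    -- At the last rank no index follows, and only the lower bound r on the exponent has to be
    -- checked.
    · have hjn : (j : ℕ) + 1 = n := by have := j.isLt; omega
      refine ⟨?_, fun l hl => absurd ?_ hl⟩
      · have e := congrFun h i
        rw [lead_apply, lead_apply, hrank, hi, tail_eq, tail_eq q.1.2, hjn, tail_eq_zero,
          tail_eq_zero] at e
        have : r * (q.1.2 j + 1) ≤ r * p.1.2 j := Nat.mul_le_mul_left _ hlt
        simp only [add_zero] at e
        linarith
      · have := rank_lt q.1.1 l
        simp only [top, mem_filter, mem_univ, true_and]
        omega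
  have hgap : IsGap r q.1.1 univ (top q.1.1 j) :=
    { subset := subset_univ _
      le := fun x hx => by
        rcases eq_or_lt_of_le (hle x hx) with e | e
        · rw [← key_injective _ e]; exact hr'.1
        · have := hr'.1
          rcases key_lt_key_iff.1 e with h | h <;> omega
      lt := fun x hx l hl => (hr'.2 l (mem_sdiff.1 hl).2).trans_le (hle x hx) }
  have h1 := q.2.1 _ hgap
  rw [card_top _ j.isLt] at h1
  have h2 := p.2.2 j (Nat.ne_of_gt (Nat.zero_lt_of_lt hlt))
  omega

lemma lead_injective : Function.Injective (lead (n := n) (k := k) (r := r)) := by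
  intro p q h
  have h2 : p.1.2 = q.1.2 := le_antisymm (snd_le_of_lead_eq h) (snd_le_of_lead_eq h.symm)
  have hrank : rank p.1.1 = rank q.1.1 := by rw [← rank_lead, h, rank_lead]
  have h1 : p.1.1 = q.1.1 := by
    funext i
    have e := congrFun h i
    rw [lead_apply, lead_apply, hrank, h2] at e
    omega
  exact Subtype.ext (Prod.ext h1 h2)

lemma normalElt_mul_esymmOn (p : NormalIndex n k r) {d : ℕ} (hd : n - k < d) (hdn : d ≤ n) :
    ∃ q : NormalIndex n k r, q.1.2 ≠ 0 ∧ deg q = deg p + r * d ∧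
      normalElt q = normalElt p * esymmOn r univ d := by
  obtain ⟨j, rfl⟩ : ∃ j : Fin n, d = j + 1 := ⟨⟨d - 1, by omega⟩, by simp; omega⟩
  refine ⟨⟨(p.1.1, p.1.2 + Pi.single j 1), p.2.1, fun t ht => ?_⟩, fun h => ?_, ?_, ?_⟩
  · rcases eq_or_ne t j with rfl | htj
    · exact hd
    · exact p.2.2 t (by simpa [htj] using ht)
  · simpa using congrFun h j
  · simp [deg, add_mul, sum_add_distrib, Pi.single_apply]
    ring
  · simp only [normalElt, Pi.add_apply, pow_add, prod_mul_distrib, mul_assoc]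
    congr 2
    rw [prod_eq_single j] <;> simp +contextual

/-- The index of a monomial without large gap sets. -/
def monIndex (a : Fin n → ℕ) (ha : NoGap k r a) : NormalIndex n k r :=
  ⟨(a, 0), ha, fun _ h => absurd rfl h⟩

lemma normalElt_monIndex (a : Fin n → ℕ) (ha : NoGap k r a) :
    normalElt (monIndex a ha) = mon a := by
  simp [normalElt, monIndex]

lemma mon_mem_span_normalElt (hr : 0 < r) (a : Fin n → ℕ) :
    mon a ∈ Submodule.span ℂ (normalElt '' {p : NormalIndex n k r | deg p = ∑ i, a i}) := by
  by_cases hg : NoGap k r a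
  · exact Submodule.subset_span ⟨monIndex a hg, by simp [deg, monIndex], normalElt_monIndex a hg⟩
  simp only [NoGap, not_forall, not_le] at hg
  obtain ⟨S, hS, hcard⟩ := hg
  refine mon_mem_of_isGap hr hS _ ?_ fun b hb _ hsum => ?_
  · have hn : 0 < n := by
      have := card_le_univ S
      simp at this; omega
    have hlt : weight (a - ind r S) < weight a := by
      conv_rhs => rw [← sub_ind_add_ind hS, weight_add_ind]
      have : 0 < #S * (r * n) ^ 2 := by
        have : 0 < #S := by omega
        positivity
      omega
    have ih := mon_mem_span_normalElt hr (a - ind r S)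
    have := Submodule.mem_map_of_mem (f := LinearMap.mulRight ℂ (esymmOn r univ #S)) ih
    rw [Submodule.map_span] at this
    refine Submodule.span_mono ?_ this
    rintro _ ⟨_, ⟨p, hp, rfl⟩, rfl⟩
    obtain ⟨q, -, hq, e⟩ := normalElt_mul_esymmOn p hcard (by simpa using card_le_univ S)
    refine ⟨q, ?_, e⟩
    have e2 : ∑ i, a i = ∑ i, (a - ind r S + ind r S) i := by rw [sub_ind_add_ind hS]
    simp only [Set.mem_ofPred_eq] at hp ⊢
    rw [hq, hp, e2]
    simp only [Pi.add_apply, sum_add_distrib, sum_ind]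
  · have := mon_mem_span_normalElt hr b
    rwa [hsum] at this
  termination_by weight a

lemma span_normalElt (hr : 0 < r) :
    Submodule.span ℂ (Set.range (normalElt (n := n) (k := k) (r := r))) = ⊤ := by
  rw [eq_top_iff, ← span_mon, Submodule.span_le]
  rintro _ ⟨a, rfl⟩
  exact Submodule.span_mono (Set.image_subset_range _ _) (mon_mem_span_normalElt hr a)

lemma linearIndependent_mon : LinearIndependent ℂ (mon (n := n)) := by
  have h := (basisMonomials (Fin n) ℂ).linearIndependent.comp _
    (Finsupp.equivFunOnFinite (α := Fin n) (M := ℕ)).symm.injective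
  rw [show mon = _ from funext fun a => mon_eq_monomial (n := n) a]
  simpa [Function.comp_def] using h

/-- In degree at most W these elements span all monomials, and `lead` shows that there are no more
of them than monomials. That `lead` gives actual leading terms is not needed. -/
lemma linearIndependent_normalElt (hr : 0 < r) :
    LinearIndependent ℂ (normalElt (n := n) (k := k) (r := r)) := by
  rw [linearIndependent_iff_finset_linearIndependent]
  intro s
  set W := s.sup deg
  have hfin : {a : Fin n → ℕ | ∑ i, a i ≤ W}.Finite :=
    (Set.finite_Iic (fun _ => W)).subset fun a ha i =>
      (single_le_sum (fun _ _ => Nat.zero_le _) (mem_univ i)).trans ha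
  let P : Set (NormalIndex n k r) := {p | deg p ≤ W}
  let A : Set (Fin n → ℕ) := {a | ∑ i, a i ≤ W}
  have : Finite A := hfin
  let φ : P → A := fun p => ⟨lead p.1, (sum_lead p.1).trans_le p.2⟩
  have hφ : Function.Injective φ := fun p q h =>
    Subtype.ext (lead_injective (congrArg Subtype.val h))
  have : Finite P := Finite.of_injective φ hφ
  have := Fintype.ofFinite A
  have := Fintype.ofFinite P
  have hP : LinearIndependent ℂ (fun p : P => normalElt p.1) := by
    rw [linearIndependent_iff_card_le_finrank_span, Set.finrank]
    refine (Fintype.card_le_of_injective φ hφ).trans ?_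
    rw [← finrank_span_eq_card (linearIndependent_mon.comp (Subtype.val : A → _)
      Subtype.val_injective)]
    have : FiniteDimensional ℂ
        (Submodule.span ℂ (Set.range fun p : P => normalElt p.1)) :=
      FiniteDimensional.span_of_finite ℂ (Set.finite_range _)
    refine Submodule.finrank_mono (Submodule.span_le.2 ?_)
    rintro _ ⟨a, rfl⟩
    refine Submodule.span_mono ?_ (mon_mem_span_normalElt (k := k) hr a.1)
    rintro _ ⟨p, hp, rfl⟩
    exact ⟨⟨p, le_of_eq_of_le hp a.2⟩, rfl⟩
  exact hP.comp (fun p : s => ⟨p.1, le_sup (f := deg) p.2⟩) fun p q h =>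
    Subtype.ext (congrArg (fun x : P => x.1) h)

/-! ### The good monomials form a basis of the quotient. -/

lemma idealE_le (hr : 0 < r) :
    (idealE n k r).restrictScalars ℂ ≤
      Submodule.span ℂ (normalElt '' {p : NormalIndex n k r | p.1.2 ≠ 0}) := by
  rw [idealE, Ideal.span, ← Submodule.span_smul_of_span_eq_top (span_normalElt (k := k) hr),
    Submodule.span_le]
  rintro _ ⟨_, ⟨p, rfl⟩, _, ⟨d, hd, hdn, rfl⟩, rfl⟩
  obtain ⟨q, hq, -, e⟩ := normalElt_mul_esymmOn p hd hdn
  exact Submodule.subset_span ⟨q, hq, by simp [e, esymmPow_eq]⟩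

/-- The two subspaces lie in the spans of disjoint parts of the adapted basis. -/
lemma disjoint_span_good_idealI (hr : 0 < r) :
    Disjoint (Submodule.span ℂ (mon '' {b : Fin n → ℕ | Good k r b}))
      ((idealI n k r).restrictScalars ℂ) := by
  have h := (linearIndependent_normalElt (n := n) (k := k) hr).disjoint_span_image
    (s := {p | p.1.2 = 0 ∧ Good k r p.1.1}) (t := {p | p.1.2 ≠ 0 ∨ ¬ Good k r p.1.1}) (by
      rw [Set.disjoint_left]
      rintro p ⟨h1, h2⟩ (h | h)
      exacts [h h1, h h2])
  refine h.mono (Submodule.span_mono ?_) ((idealI_le hr).trans (sup_le ?_ ?_))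
  · rintro _ ⟨b, hb, rfl⟩
    exact ⟨monIndex b hb.1, ⟨rfl, hb⟩, normalElt_monIndex b hb.1⟩
  · exact (idealE_le hr).trans (Submodule.span_mono (Set.image_mono fun p hp => Or.inl hp))
  · refine Submodule.span_mono ?_
    rintro _ ⟨b, ⟨hb, i, hi⟩, rfl⟩
    exact ⟨monIndex b hb, Or.inr fun h => hi.not_ge (h.2 i), normalElt_monIndex b hb⟩

lemma exists_basis_good (hr : 0 < r) :
    ∃ b : Module.Basis (mon '' {b : Fin n → ℕ | Good k r b}) ℂ (ringR n k r),
      ∀ f, b f = Ideal.Quotient.mk (idealI n k r) (f : MvPolynomial (Fin n) ℂ) := by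
  set G : Set (MvPolynomial (Fin n) ℂ) := mon '' {b : Fin n → ℕ | Good k r b}
  let π : MvPolynomial (Fin n) ℂ →ₗ[ℂ] ringR n k r := (Ideal.Quotient.mkₐ ℂ (idealI n k r)).toLinearMap
  have hker : LinearMap.ker π = (idealI n k r).restrictScalars ℂ := by
    ext f
    simp [π, Ideal.Quotient.eq_zero_iff_mem]
  have hG : LinearIndependent ℂ (Subtype.val : G → MvPolynomial (Fin n) ℂ) :=
    linearIndependent_mon.linearIndepOn_id.mono (Set.image_subset_range _ _)
  have hli : LinearIndependent ℂ (π ∘ (Subtype.val : G → MvPolynomial (Fin n) ℂ)) :=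
    hG.map (by rw [hker, Subtype.range_coe]; exact disjoint_span_good_idealI hr)
  have hsp : ⊤ ≤ Submodule.span ℂ (Set.range (π ∘ (Subtype.val : G → MvPolynomial (Fin n) ℂ))) := by
    have htop : (idealI n k r).restrictScalars ℂ ⊔ Submodule.span ℂ G = ⊤ := by
      rw [eq_top_iff, ← span_mon, Submodule.span_le]
      rintro _ ⟨a, rfl⟩
      exact mon_mem_span_good hr a
    have h := congrArg (Submodule.map π) htop
    rw [Submodule.map_sup, Submodule.map_top, ← hker, Submodule.map_span,
      LinearMap.range_eq_top.2 (Ideal.Quotient.mkₐ_surjective ℂ _), (LinearMap.le_ker_iff_map).1 le_rfl,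
      bot_sup_eq] at h
    rw [Set.range_comp, Subtype.range_coe, h]
  exact ⟨Module.Basis.mk hli hsp, fun f => by rw [Module.Basis.mk_apply]; rfl⟩

/-! ### Descents and exponents of colored words. -/

variable {m : ℕ}

namespace ColoredPerm

lemma mem_Des_iff {g : ColoredPerm n r m} {p : ℕ} (h : p + 1 < m) :
    (⟨p, by omega⟩ : Fin m) ∈ g.Des ↔
      (g.color ⟨p, by omega⟩ : ℕ) < g.color ⟨p + 1, h⟩ ∨
        ((g.color ⟨p + 1, h⟩ : ℕ) = g.color ⟨p, by omega⟩ ∧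
          g.letter ⟨p + 1, h⟩ < g.letter ⟨p, by omega⟩) := by
  simp [Des, ColoredLT, entry, h, Fin.ext_iff]

lemma succ_lt_of_mem_Des {g : ColoredPerm n r m} {p : Fin m} (h : p ∈ g.Des) :
    (p : ℕ) + 1 < m := by
  simp only [Des, mem_filter, mem_univ, true_and] at h
  exact h.1

open scoped Classical in
lemma d_eq (g : ColoredPerm n r m) {p : ℕ} (h : p + 1 < m) :
    g.d ⟨p, by omega⟩ =
      g.d ⟨p + 1, h⟩ + if (⟨p, by omega⟩ : Fin m) ∈ g.Des then 1 else 0 := by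
  have h1 : g.Des.filter (fun j => (⟨p, by omega⟩ : Fin m) ≤ j) =
      g.Des.filter (fun j => (⟨p + 1, h⟩ : Fin m) ≤ j) ∪
        g.Des.filter (fun j => j = ⟨p, by omega⟩) := by
    ext j
    simp only [mem_filter, mem_union, Fin.le_def, Fin.ext_iff, ← and_or_left]
    refine and_congr_right fun _ => ?_
    omega
  have h2 : Disjoint (g.Des.filter (fun j => (⟨p + 1, h⟩ : Fin m) ≤ j))
      (g.Des.filter (fun j => j = ⟨p, by omega⟩)) := by
    rw [disjoint_left]
    rintro j hj hj'
    have := (mem_filter.1 hj).2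
    rw [(mem_filter.1 hj').2, Fin.le_def] at this
    simp at this
  rw [d, h1, card_union_of_disjoint h2, filter_eq', d]
  congr 1
  split_ifs <;> simp

lemma d_le_des (g : ColoredPerm n r m) (p : Fin m) : g.d p ≤ g.des := card_filter_le _ _

lemma d_zero (g : ColoredPerm n r m) (h : 0 < m) : g.d ⟨0, h⟩ = g.des := by
  rw [d, des, filter_true_of_mem]
  intro j _
  simp [Fin.le_def]

lemma d_last (g : ColoredPerm n r m) {p : Fin m} (h : (p : ℕ) + 1 = m) : g.d p = 0 := by
  rw [d, card_eq_zero, filter_eq_empty_iff]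
  intro j hj hpj
  have := succ_lt_of_mem_Des hj
  rw [Fin.le_def] at hpj
  omega

lemma des_lt (g : ColoredPerm n r m) (h : 0 < m) : g.des < m := by
  have := card_lt_univ_of_notMem (s := g.Des) (x := ⟨m - 1, by omega⟩)
    fun hj => by have := succ_lt_of_mem_Des hj; simp at this; omega
  simpa [des] using this

lemma suffix_letter (g : ColoredPerm n r m) (z : ℕ) (p : Fin (m - z)) :
    (g.suffix z).letter p = g.letter ⟨z + p, by omega⟩ := rfl

/-- A sequence of extra exponents, extended by zeros. -/
def extend (m k : ℕ) (e : Fin (m - k) → ℕ) (p : Fin m) : ℕ :=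
  if h : (p : ℕ) < m - k then e ⟨p, h⟩ else 0

lemma extendedMonomial_eq (g : ColoredPerm n r m) (k : ℕ) (e : Fin (m - k) → ℕ) :
    g.extendedMonomial k e =
      ∏ p, X (g.letter p) ^ (r * (g.d p + extend m k e p) + (g.color p : ℕ)) := by
  have h : ∏ j : Fin (m - k), (X (g.letter (Fin.castLE (Nat.sub_le m k) j)) ^ (r * e j) :
      MvPolynomial (Fin n) ℂ) = ∏ p, X (g.letter p) ^ (r * extend m k e p) := by
    refine Fintype.prod_of_injective (Fin.castLE (Nat.sub_le m k)) (Fin.castLE_injective _) _ _ ?_ ?_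
    · intro p hp
      have : ¬ (p : ℕ) < m - k := fun h => hp ⟨⟨p, h⟩, rfl⟩
      simp [extend, this]
    · intro j
      simp [extend]
  rw [extendedMonomial, h, descentMonomial, ← prod_mul_distrib]
  refine prod_congr rfl fun p _ => ?_
  rw [← pow_add]
  ring

end ColoredPerm

open ColoredPerm

/-- The products in the second description of the extended descent monomials. -/
def IsShiftedDescentMonomial (n k r : ℕ) (f : MvPolynomial (Fin n) ℂ) : Prop :=
  ∃ Z : Finset (Fin n), #Z ≤ n - k ∧ ∃ q ∈ descentMonomials n k r Zᶜ,
    f = (∏ j ∈ Z, X j ^ (k * r)) * q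

lemma mon_eq_of_apply_eq {a : Fin n → ℕ} {Z : Finset (Fin n)} {l : Fin m ↪ Fin n}
    (hl : univ.map l = Zᶜ) {s : ℕ} (hZ : ∀ i ∈ Z, a i = s) :
    mon a = (∏ j ∈ Z, X j ^ s) * ∏ p, X (l p) ^ a (l p) := by
  rw [mon, ← prod_mul_prod_compl Z, ← hl, prod_map]
  congr 1
  exact prod_congr rfl fun i hi => by rw [hZ i hi]

lemma card_of_map_eq_compl {Z : Finset (Fin n)} {l : Fin m ↪ Fin n} (hl : univ.map l = Zᶜ) :
    m + #Z = n := by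
  have := congrArg card hl
  rw [card_map, card_compl, card_univ, Fintype.card_fin, Fintype.card_fin] at this
  have := card_le_univ Z
  rw [Fintype.card_fin] at this
  omega

/-! ### Descent monomials have good exponent vectors. -/

/-- Near the end of the word, the exponents leave no room for a gap. -/
lemma noGap_of_exponents {a : Fin n → ℕ} {Z : Finset (Fin n)} (hk : k ≤ n) (hZ : #Z ≤ n - k)
    {g : ColoredPerm n r m} (hg : univ.map g.letter = Zᶜ)
    (ha : ∀ p : Fin m, m - k ≤ p → a (g.letter p) = r * g.d p + g.color p) : NoGap k r a := by
  classical
  intro S hS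
  by_contra hcard
  have hm := card_of_map_eq_compl hg
  -- The complement of S has fewer than k elements, so it cannot contain the last k letters.
  obtain ⟨p₁, hp₁, hp₁S⟩ : ∃ p : Fin m, m - k ≤ p ∧ g.letter p ∈ S := by
    by_contra! h
    set T : Finset (Fin m) := univ.filter fun p : Fin m => ¬ (p : ℕ) < m - k
    have h1 : #(T.map g.letter) ≤ #Sᶜ := by
      refine card_le_card fun i hi => ?_
      obtain ⟨p, hp, rfl⟩ := mem_map.1 hi
      exact mem_compl.2 (h p (not_lt.1 (mem_filter.1 hp).2))
    have h2 : #(univ.filter fun p : Fin m => (p : ℕ) < m - k) + #T = #univ :=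
      card_filter_add_card_filter_not _
    rw [Fin.card_filter_val_lt, card_univ, Fintype.card_fin] at h2
    have h3 := card_le_univ S
    rw [Fintype.card_fin] at h3
    rw [card_map, card_compl, Fintype.card_fin] at h1
    omega
  -- Beyond the last letter of S the gap fails: at a descent the exponent drop is too small by the
  -- definition of descent, elsewhere it is below r, and the final letter has exponent below r.
  obtain ⟨p, hp, hmax⟩ := exists_max_image ((univ : Finset (Fin m)).filter fun p => g.letter p ∈ S)
    (fun p => (p : ℕ)) ⟨p₁, by simpa using hp₁S⟩
  have hpS : g.letter p ∈ S := by simpa using hp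
  have hpk : m - k ≤ p := hp₁.trans (hmax p₁ (by simpa using hp₁S))
  have hap := ha p hpk
  have hc := (g.color p).isLt
  by_cases hlast : (p : ℕ) + 1 < m
  · have hnS : g.letter ⟨p + 1, hlast⟩ ∉ S := fun h => by
      have := hmax ⟨p + 1, hlast⟩ (by simpa using h)
      simp at this
    have hlt := key_add_lt_key_iff.1 (hS.lt _ hpS _ (mem_sdiff.2 ⟨mem_univ _, hnS⟩))
    have hap' := ha ⟨p + 1, hlast⟩ (by simp; omega)
    have hd := g.d_eq hlast
    simp only [Fin.eta] at hd
    rw [hap, hap', hd] at hlt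
    have hdes := mem_Des_iff (g := g) hlast
    simp only [Fin.eta] at hdes
    split_ifs at hlt with h
    · rw [mul_add] at hlt
      rcases hdes.1 h with h | h
      · omega
      · have := h.2
        rw [Fin.lt_def] at this
        simp only [Fin.lt_def] at hlt
        omega
    · rw [hdes] at h
      rw [add_zero] at hlt
      omega
  · have := hS.le _ hpS
    rw [hap, g.d_last (by have := p.isLt; omega)] at this
    omega

lemma good_of_isShiftedDescentMonomial (hk : k ≤ n) {f : MvPolynomial (Fin n) ℂ}
    (hf : IsShiftedDescentMonomial n k r f) : ∃ a, Good k r a ∧ mon a = f := by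
  obtain ⟨Z, hZ, _, ⟨m, g, e, hg, ⟨hdes, -, he⟩, rfl⟩, rfl⟩ := hf
  set E : Fin m → ℕ := fun p => r * (g.d p + extend m k e p) + (g.color p : ℕ)
  set a : Fin n → ℕ := Function.extend g.letter E fun _ => k * r
  have ha : ∀ p, a (g.letter p) = E p := fun p => g.letter.injective.extend_apply _ _ _
  have haZ : ∀ i ∈ Z, a i = k * r := by
    intro i hi
    refine Function.extend_apply' _ _ _ ?_
    rintro ⟨p, rfl⟩
    have : g.letter p ∈ Zᶜ := hg ▸ mem_map_of_mem _ (mem_univ p)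
    exact mem_compl.1 this hi
  refine ⟨a, ⟨noGap_of_exponents hk hZ hg fun p hp => ?_, fun i => ?_⟩, ?_⟩
  · rw [ha]
    simp [E, extend, hp]
  · by_cases hi : i ∈ Z
    · exact (haZ i hi).le
    · rw [← mem_compl, ← hg] at hi
      obtain ⟨p, -, rfl⟩ := mem_map.1 hi
      rw [ha]
      -- One unit is left over to absorb the color, which is below r.
      have hlt : g.d p + extend m k e p + 1 ≤ k := by
        have := g.d_le_des p
        simp only [extend]
        split_ifs with h
        · have := he ⟨p, h⟩; omega
        · omega
      have := Nat.mul_le_mul_left r hlt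
      have := (g.color p).isLt
      simp only [E]
      nlinarith
  · rw [mon_eq_of_apply_eq hg haZ, extendedMonomial_eq]
    simp only [ha, E]

/-! ### Good exponent vectors come from sorted words. -/

/-- The indices in `U`, listed in the order given by the keys. -/
lemma exists_enumeration (a : Fin n → ℕ) (U : Finset (Fin n)) :
    ∃ l : Fin #U ↪ Fin n, univ.map l = U ∧ ∀ p q, p < q → key a (l q) < key a (l p) := by
  set V := U.map ⟨key a, key_injective a⟩
  have hV : #V = #U := card_map _
  have : ∀ p : Fin #U, ∃ i ∈ U, key a i = V.orderEmbOfFin hV p.rev := fun p =>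
    mem_map.1 (V.orderEmbOfFin_mem hV p.rev)
  choose l hlU hl using this
  have hinj : Function.Injective l := fun p q h => by
    have := hl p
    rw [h, hl q] at this
    simpa using this.symm
  refine ⟨⟨l, hinj⟩, eq_of_subset_of_card_le ?_ (by simp), fun p q h => ?_⟩
  · intro i hi
    obtain ⟨p, -, rfl⟩ := mem_map.1 hi
    exact hlU p
  · simp only [Function.Embedding.coeFn_mk]
    rw [hl, hl]
    simpa using h

section Sorted

variable {a : Fin n → ℕ} {g : ColoredPerm n r m}

/-- With equal quotients, sorting by keys orders the remainders and then the letters so that there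
is no descent. Hence the quotient drops at every descent. -/
lemma div_add_le_of_sorted (hc : ∀ p, (g.color p : ℕ) = a (g.letter p) % r)
    (hs : ∀ p q, p < q → key a (g.letter q) < key a (g.letter p)) {p : ℕ} (h : p + 1 < m) :
    a (g.letter ⟨p + 1, h⟩) / r + g.d ⟨p, by omega⟩ ≤
      a (g.letter ⟨p, by omega⟩) / r + g.d ⟨p + 1, h⟩ := by
  have hlt := key_lt_key_iff.1 (hs ⟨p, by omega⟩ ⟨p + 1, h⟩ (by simp [Fin.lt_def]))
  have hle := Nat.div_le_div_right (c := r) (hlt.elim le_of_lt fun h => h.1.le)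
  rw [g.d_eq h]
  split_ifs with hd
  · rw [mem_Des_iff h, hc, hc] at hd
    have e1 := Nat.div_add_mod (a (g.letter ⟨p, by omega⟩)) r
    have e2 := Nat.div_add_mod (a (g.letter ⟨p + 1, h⟩)) r
    by_contra hcon
    have heq : a (g.letter ⟨p + 1, h⟩) / r = a (g.letter ⟨p, by omega⟩) / r := by omega
    rw [heq] at e2
    rcases hd with hd | ⟨hd, hd'⟩
    · omega
    · rcases hlt with hlt | ⟨-, hlt⟩
      · omega
      · exact lt_asymm hd' hlt
  · omega

/-- Without a gap the quotient drops by at most one, and at a non-descent not at all; this is the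
reverse of `div_add_le_of_sorted`. -/
lemma div_le_add_of_not_gap (hc : ∀ p, (g.color p : ℕ) = a (g.letter p) % r)
    {p : ℕ} (h : p + 1 < m)
    (hgap : ¬ key a (g.letter ⟨p + 1, h⟩) + r * n < key a (g.letter ⟨p, by omega⟩)) :
    a (g.letter ⟨p, by omega⟩) / r + g.d ⟨p + 1, h⟩ ≤
      a (g.letter ⟨p + 1, h⟩) / r + g.d ⟨p, by omega⟩ := by
  have hr := (g.color ⟨p, by omega⟩).pos
  have hne : g.letter ⟨p, by omega⟩ ≠ g.letter ⟨p + 1, h⟩ := fun e => by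
    simpa using g.letter.injective e
  have e1 := Nat.div_add_mod (a (g.letter ⟨p, by omega⟩)) r
  have e2 := Nat.div_add_mod (a (g.letter ⟨p + 1, h⟩)) r
  have m2 := Nat.mod_lt (a (g.letter ⟨p + 1, h⟩)) hr
  rw [key_add_lt_key_iff] at hgap
  push Not at hgap
  rw [g.d_eq h]
  by_contra hcon
  split_ifs at hcon with hd
  · have := Nat.mul_le_mul_left r (show a (g.letter ⟨p + 1, h⟩) / r + 2 ≤
      a (g.letter ⟨p, by omega⟩) / r by omega)
    rw [mul_add] at this
    omega
  · have := Nat.mul_le_mul_left r (show a (g.letter ⟨p + 1, h⟩) / r + 1 ≤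
      a (g.letter ⟨p, by omega⟩) / r by omega)
    rw [mem_Des_iff h, hc, hc] at hd
    push Not at hd
    rw [mul_add] at this
    have h1 := hd.2 (by omega)
    have h2 := hgap.2 (by omega)
    exact hne (le_antisymm h1 h2)

lemma div_sub_d_anti (hc : ∀ p, (g.color p : ℕ) = a (g.letter p) % r)
    (hs : ∀ p q, p < q → key a (g.letter q) < key a (g.letter p)) {p : ℕ} :
    ∀ t, ∀ h : p + t < m, a (g.letter ⟨p + t, h⟩) / r + g.d ⟨p, by omega⟩ ≤
      a (g.letter ⟨p, by omega⟩) / r + g.d ⟨p + t, h⟩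
  | 0, h => le_rfl
  | t + 1, h => by
    have h1 := div_sub_d_anti hc hs (p := p) t (by omega)
    have h2 := div_add_le_of_sorted hc hs (p := p + t) h
    simp only [← add_assoc] at h1 h2 ⊢
    omega

lemma d_le_div (hc : ∀ p, (g.color p : ℕ) = a (g.letter p) % r)
    (hs : ∀ p q, p < q → key a (g.letter q) < key a (g.letter p)) (p : Fin m) :
    g.d p ≤ a (g.letter p) / r := by
  obtain ⟨p, hp⟩ := p
  have h := div_sub_d_anti hc hs (p := p) (m - 1 - p) (by omega)
  rw [g.d_last (p := ⟨p + (m - 1 - p), _⟩) (by simp; omega)] at h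
  exact (Nat.le_add_left _ _).trans h

/-- If there are no large gap sets, the exponents near the end of the word are minimal. -/
lemma div_le_d_of_noGap {Z : Finset (Fin n)}
    (hZ : ∀ i ∈ Z, a i = k * r) (hZ' : ∀ i ∉ Z, a i < k * r) (hg : univ.map g.letter = Zᶜ)
    (ha : NoGap k r a) (hc : ∀ p, (g.color p : ℕ) = a (g.letter p) % r)
    (hs : ∀ p q, p < q → key a (g.letter q) < key a (g.letter p)) :
    ∀ t, ∀ p : Fin m, m - k ≤ p → (p : ℕ) + t + 1 = m → a (g.letter p) / r ≤ g.d p := by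
  have hm := card_of_map_eq_compl hg
  -- Otherwise all indices except the fewer than k letters after p would form a gap set.
  have hgap : ∀ p : Fin m, m - k ≤ p → r ≤ a (g.letter p) →
      ∃ q, p < q ∧ ¬ key a (g.letter q) + r * n < key a (g.letter p) := by
    intro p hp hra
    by_contra! hcon
    have hpZ : g.letter p ∉ Z := by
      rw [← mem_compl, ← hg]; exact mem_map_of_mem _ (mem_univ p)
    have hle : ∀ i ∉ (Ioi p).map g.letter, a (g.letter p) ≤ a i ∧
        key a (g.letter p) ≤ key a i := by
      intro i hi
      by_cases hiZ : i ∈ Z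
      · have h1 := hZ i hiZ
        have h2 := hZ' _ hpZ
        exact ⟨by omega, (key_lt_key_iff.2 (Or.inl (by omega))).le⟩
      · rw [← mem_compl, ← hg] at hiZ
        obtain ⟨q, -, rfl⟩ := mem_map.1 hiZ
        have hqp : q ≤ p := by simpa using hi
        rcases hqp.eq_or_lt with rfl | hlt
        · exact ⟨le_rfl, le_rfl⟩
        · have := hs q p hlt
          exact ⟨(key_lt_key_iff.1 this).elim le_of_lt fun h => h.1.le, this.le⟩
    have hS : IsGap r a univ ((Ioi p).map g.letter)ᶜ :=
      { subset := subset_univ _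
        le := fun i hi => hra.trans (hle i (mem_compl.1 hi)).1
        lt := fun i hi j hj => by
          simp only [mem_sdiff, mem_univ, true_and, mem_compl, not_not] at hj
          obtain ⟨q, hq, rfl⟩ := mem_map.1 hj
          exact (hcon q (mem_Ioi.1 hq)).trans_le (hle i (mem_compl.1 hi)).2 }
    have := ha _ hS
    rw [card_compl, card_map, Fin.card_Ioi, Fintype.card_fin] at this
    omega
  intro t
  induction t with
  | zero =>
    intro p hp hpm
    by_contra hcon
    obtain ⟨q, hq, -⟩ := hgap p hp (by
      by_contra hlt
      rw [Nat.div_eq_of_lt (by omega)] at hcon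
      omega)
    have := q.isLt
    rw [Fin.lt_def] at hq
    omega
  | succ t ih =>
    rintro ⟨p, hpm'⟩ hp hpm
    simp only at hp hpm
    have ih' := ih ⟨p + 1, by omega⟩ (by simp; omega) (by simp; omega)
    by_cases hra : r ≤ a (g.letter ⟨p, hpm'⟩)
    · obtain ⟨q, hq, hqg⟩ := hgap ⟨p, hpm'⟩ hp hra
      -- A gap to the next letter would be a gap to every later one, since the keys decrease.
      have := div_le_add_of_not_gap hc (p := p) (by omega) fun h => hqg (by
        rcases (show (⟨p + 1, by omega⟩ : Fin m) ≤ q from hq).eq_or_lt with h' | hlt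
        · exact h' ▸ h
        · have := hs _ _ hlt
          omega)
      omega
    · rw [Nat.div_eq_of_lt (by omega)]
      omega

end Sorted

lemma isShiftedDescentMonomial_of_good (hr : 0 < r) (hk : 0 < k) (hkn : k ≤ n)
    {a : Fin n → ℕ} (ha : Good k r a) : IsShiftedDescentMonomial n k r (mon a) := by
  obtain ⟨hgap, hle⟩ := ha
  set Z : Finset (Fin n) := univ.filter fun i => a i = k * r
  have hZ : ∀ i ∈ Z, a i = k * r := by simp [Z]
  have hZ' : ∀ i ∉ Z, a i < k * r := fun i hi =>
    lt_of_le_of_ne (hle i) (by simpa [Z] using hi)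
  obtain ⟨l, hl, hs⟩ := exists_enumeration a Zᶜ
  generalize #Zᶜ = m at l
  let g : ColoredPerm n r m := ⟨l, fun p => ⟨a (l p) % r, Nat.mod_lt _ hr⟩⟩
  have hg : univ.map g.letter = Zᶜ := hl
  have hs : ∀ p q, p < q → key a (g.letter q) < key a (g.letter p) := hs
  have hc : ∀ p, (g.color p : ℕ) = a (g.letter p) % r := fun _ => rfl
  have hm := card_of_map_eq_compl hg
  have htail : ∀ p : Fin m, m - k ≤ p → a (g.letter p) / r = g.d p := fun p hp =>
    le_antisymm (div_le_d_of_noGap hZ hZ' hg hgap hc hs (m - 1 - p) p hp (by omega))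
      (d_le_div hc hs p)
  -- If m < k, every position is in the tail, so quotients are at most des ≤ m - 1 ≤ k - 2. Then Z
  -- is itself a gap set, with n - m > n - k elements.
  have hkm : k ≤ m := by
    by_contra hlt
    have hS : IsGap r a univ Z :=
      { subset := subset_univ _
        le := fun i hi => by rw [hZ i hi]; exact Nat.le_mul_of_pos_left r hk
        lt := fun i hi j hj => by
          have hj' : j ∈ univ.map g.letter := by rw [hg]; simpa using hj
          obtain ⟨p, -, rfl⟩ := mem_map.1 hj'
          rw [key_add_lt_key_iff, hZ i hi]
          left
          have h1 := htail p (by omega)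
          have h2 := g.d_le_des p
          have h3 := g.des_lt p.pos
          have h4 := Nat.lt_mul_div_succ (a (g.letter p)) hr
          have h5 := Nat.mul_le_mul_left r (show a (g.letter p) / r + 2 ≤ k by omega)
          nlinarith }
    have := hgap _ hS
    omega
  have hm0 : 0 < m := by omega
  have hdes : g.des ≤ a (g.letter ⟨0, hm0⟩) / r := by
    rw [← g.d_zero hm0]; exact d_le_div hc hs _
  have hlt : ∀ p, a (g.letter p) / r < k := fun p => by
    refine Nat.div_lt_of_lt_mul ?_
    rw [mul_comm]
    refine hZ' _ ?_
    rw [← mem_compl, ← hg]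
    exact mem_map_of_mem _ (mem_univ p)
  have hanti : ∀ p q : Fin m, p ≤ q →
      a (g.letter q) / r + g.d p ≤ a (g.letter p) / r + g.d q := by
    rintro ⟨p, hp⟩ ⟨q, hq⟩ hpq
    obtain ⟨t, rfl⟩ := Nat.exists_eq_add_of_le (show p ≤ q from hpq)
    exact div_sub_d_anti hc hs t hq
  refine ⟨Z, by omega, _, ⟨m, g, fun j => a (g.letter (Fin.castLE (Nat.sub_le m k) j)) / r -
    g.d (Fin.castLE (Nat.sub_le m k) j), hg, ⟨?_, ?_, ?_⟩, rfl⟩, ?_⟩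
  · exact hdes.trans_lt (hlt _)
  · intro i j hij
    have := hanti (Fin.castLE (Nat.sub_le m k) i) (Fin.castLE (Nat.sub_le m k) j) hij
    simp only
    omega
  · intro j
    -- The extra exponent is largest at the first letter, where d equals des and the quotient is
    -- below k.
    have h1 := hanti ⟨0, hm0⟩ (Fin.castLE (Nat.sub_le m k) j) (by simp [Fin.le_def])
    have h2 := hlt ⟨0, hm0⟩
    rw [g.d_zero] at h1
    simp only
    omega
  · rw [mon_eq_of_apply_eq hg hZ, extendedMonomial_eq]
    congr 1
    refine prod_congr rfl fun p _ => ?_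
    congr 1
    have h1 := d_le_div hc hs p
    have h2 : g.d p + extend m k (fun j => a (g.letter (Fin.castLE (Nat.sub_le m k) j)) / r -
        g.d (Fin.castLE (Nat.sub_le m k) j)) p = a (g.letter p) / r := by
      simp only [extend]
      split_ifs with h
      · have : Fin.castLE (Nat.sub_le m k) ⟨p, h⟩ = p := rfl
        rw [this]
        omega
      · rw [htail p (by omega)]; rfl
    rw [h2, hc, Nat.div_add_mod]

lemma mem_extendedDescentMonomials_iff (hr : 0 < r) (hk : 1 ≤ k)
    (f : MvPolynomial (Fin n) ℂ) :
    f ∈ extendedDescentMonomials n k r ↔ IsShiftedDescentMonomial n k r f := by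
  classical
  rw [extendedDescentMonomials, if_neg (by omega)]
  constructor
  · rintro ⟨z, g, e, hz, hadm, rfl⟩
    refine ⟨(univ.filter fun j : Fin n => (j : ℕ) < z).map g.letter, ?_, _,
      ⟨n - z, g.suffix z, e, ?_, hadm, rfl⟩, ?_⟩
    · rw [card_map, Fin.card_filter_val_lt]
      omega
    · ext i
      obtain ⟨j, rfl⟩ := Finite.surjective_of_injective g.letter.injective i
      simp only [mem_map, mem_univ, true_and, mem_compl, mem_filter, suffix_letter,
        g.letter.injective.eq_iff, exists_eq_right, not_lt]
      constructor
      · rintro ⟨p, rfl⟩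
        exact Nat.le_add_right _ _
      · intro h
        exact ⟨⟨j - z, by omega⟩, Fin.ext (by simp; omega)⟩
    · rw [prod_map]
  · rintro ⟨Z, hZ, _, ⟨m, g, e, hg, hadm, rfl⟩, rfl⟩
    have hm := card_of_map_eq_compl hg
    obtain rfl : m = n - #Z := by omega
    have hmem : ∀ p, g.letter p ∉ Z := fun p => by
      rw [← mem_compl, ← hg]; exact mem_map_of_mem _ (mem_univ p)
    set o := Z.orderEmbOfFin rfl
    let L : Fin n → Fin n := fun j => if h : (j : ℕ) < #Z then o ⟨j, h⟩ else
      g.letter ⟨j - #Z, by omega⟩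
    have hL : Function.Injective L := by
      intro i j hij
      simp only [L] at hij
      split_ifs at hij with hi hj hj
      · have := o.injective hij
        exact Fin.ext (by simpa using this)
      · exact absurd (hij ▸ Z.orderEmbOfFin_mem rfl ⟨i, hi⟩) (hmem _)
      · exact absurd (hij ▸ Z.orderEmbOfFin_mem rfl ⟨j, hj⟩) (hmem _)
      · have := g.letter.injective hij
        simp only [Fin.mk.injEq] at this
        exact Fin.ext (by omega)
    -- The prefix enumerates Z; its colors do not enter the monomial, so 0 is an arbitrary choice.
    let G : ColoredPerm n r n := ⟨⟨L, hL⟩, fun j => if h : (j : ℕ) < #Z then ⟨0, hr⟩ else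
      g.color ⟨j - #Z, by omega⟩⟩
    have hG : G.suffix #Z = g := by
      have h1 : (G.suffix #Z).letter = g.letter := by
        ext p
        simp [suffix, G, L]
      have h2 : (G.suffix #Z).color = g.color := by
        ext p
        simp [suffix, G]
      rcases g with ⟨l, c⟩
      simp only at h1 h2
      rw [← h1, ← h2]
    refine ⟨#Z, G, e, hZ, hG ▸ hadm, ?_⟩
    rw [hG]
    congr 1
    have hmap : (univ.filter fun j : Fin n => (j : ℕ) < #Z).map G.letter = Z := by
      refine eq_of_subset_of_card_le ?_ ?_
      · intro i hi
        obtain ⟨j, hj, rfl⟩ := mem_map.1 hi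
        have hj' := (mem_filter.1 hj).2
        simp only [G, L, Function.Embedding.coeFn_mk, hj', dif_pos]
        exact Z.orderEmbOfFin_mem rfl _
      · rw [card_map, Fin.card_filter_val_lt]
        omega
    conv_lhs => rw [← hmap, prod_map]

lemma extendedDescentMonomials_eq (hr : 0 < r) (hk : k ≤ n) :
    extendedDescentMonomials n k r = mon '' {a : Fin n → ℕ | Good k r a} := by
  ext f
  rcases Nat.eq_zero_or_pos k with rfl | hk0
  · rw [extendedDescentMonomials, if_pos rfl, Set.mem_singleton_iff]
    constructor
    · rintro rfl
      exact ⟨0, ⟨fun S _ => by simpa using card_le_univ S, by simp⟩, mon_zero⟩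
    · rintro ⟨a, ha, rfl⟩
      rw [show a = 0 from funext fun i => by simpa using ha.2 i, mon_zero]
  · rw [mem_extendedDescentMonomials_iff hr hk0]
    constructor
    · exact good_of_isShiftedDescentMonomial hk
    · rintro ⟨a, ha, rfl⟩
      exact isShiftedDescentMonomial_of_good hr hk0 hk ha

end DescentBasis

end

theorem mainTheorem8 (n k r : ℕ) (hn : 1 ≤ n) (hk : k ≤ n) (hr : 2 ≤ r) :
    (∃ b : Module.Basis (DescentBasis.extendedDescentMonomials n k r) ℂ
        (DescentBasis.ringR n k r),
      ∀ f : DescentBasis.extendedDescentMonomials n k r,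
        b f = Ideal.Quotient.mk (DescentBasis.idealI n k r) (f : MvPolynomial (Fin n) ℂ)) ∧
    (1 ≤ k → ∀ f : MvPolynomial (Fin n) ℂ,
      f ∈ DescentBasis.extendedDescentMonomials n k r ↔
        ∃ Z : Finset (Fin n), Z.card ≤ n - k ∧
          ∃ q ∈ DescentBasis.descentMonomials n k r Zᶜ,
            f = (∏ j ∈ Z, MvPolynomial.X j ^ (k * r)) * q) := by
  have hr0 : 0 < r := by omega
  refine ⟨?_, fun hk0 f => DescentBasis.mem_extendedDescentMonomials_iff hr0 hk0 f⟩
  rw [DescentBasis.extendedDescentMonomials_eq hr0 hk]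
  exact DescentBasis.exists_basis_good hr0
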